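/- For $\nu\in\mathbb{C}$ and $t\in\mathbb{C}\setminus\{0\}$ let $$J_\nu(t)=\left(\frac t2\right)^{\nu}\sum_{k=0}^{\infty}\frac{(-1)^k (t^2/4)^k}{k!\,\Gamma(\nu+k+1)},$$ where $1/\Gamma$ is the entire reciprocal Gamma function and $(t/2)^\nu=e^{\nu\log(t/2)}$ with the principal logarithm ($-\pi<\arg t\le\pi$), be the Bessel function of the first kind. Let $$Y_\nu(t)=\frac{J_\nu(t)\cos(\nu\pi)-J_{-\nu}(t)}{\sin(\nu\pi)}\quad(\nu\notin\mathbb{Z}),\qquad Y_n(t)=\lim_{\nu\to n}Y_\nu(t)\quad(n\in\mathbb{Z})$$ be the Bessel function of the second kind. Then for every integer $m\ge 0$ and every $t\in\mathbb{C}$ with $t\neq 0$, the function $\nu\mapsto J_\nu(t)$ is (complex) differentiable at $\nu=m$ and at $\nu=-m$, and $$\left.\frac{\partial J_\nu(t)}{\partial\nu}\right|_{\nu=\pm m}=(\pm1)^m\left[\frac{\pi}{2}\,Y_m(t)\pm\frac{m!}{2}\sum_{k=0}^{m-1}\frac{J_k(t)}{k!\,(m-k)}\left(\frac t2\right)^{k-m}\right],$$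 where either all upper signs or all lower signs are taken. -/

import Mathlib

open scoped Topology

/-- The Bessel function of the first kind `J_ν(t)` of complex order `ν` and complex argument `t`,
given by its ascending series
`J_ν(t) = (t/2)^ν ∑_k (-1)^k (t²/4)^k / (k! Γ(ν+k+1))`, with the principal value of `(t/2)^ν`.
Since `Complex.Gamma` takes the value `0` at its poles and `0⁻¹ = 0`, the factor
`(Complex.Gamma z)⁻¹` is the entire function `1/Γ`, also at the poles of `Γ`. -/
noncomputable def besselJ (ν t : ℂ) : ℂ :=
  (t / 2) ^ ν *
    ∑' k : ℕ, (-1) ^ k * (t ^ 2 / 4) ^ k * ((Nat.factorial k : ℂ))⁻¹ *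
      (Complex.Gamma (ν + k + 1))⁻¹

/-- The quotient `(J_ν(t) cos(νπ) - J_{-ν}(t)) / sin(νπ)`, meaningful when `ν` is not an
integer. -/
noncomputable def besselYQuotient (ν t : ℂ) : ℂ :=
  (besselJ ν t * Complex.cos (ν * Real.pi) - besselJ (-ν) t) / Complex.sin (ν * Real.pi)

open Classical in
/-- The Bessel function of the second kind `Y_ν(t)`: the quotient
`(J_ν(t) cos(νπ) - J_{-ν}(t)) / sin(νπ)` when `ν` is not an integer, and the limit of that quotient
as the order tends to `ν` when `ν` is an integer. -/
noncomputable def besselY (ν t : ℂ) : ℂ :=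
  if ∃ n : ℤ, ν = (n : ℂ) then Filter.limUnder (𝓝[≠] ν) (fun μ : ℂ => besselYQuotient μ t)
  else besselYQuotient ν t

/-! The ascending series converges locally uniformly in `ν`, so `J_ν(t)` is entire in `ν`; let
`D(ν)` be its derivative in the order. Both formulas are half the sum and half the difference of two
identities. `D(m) + (-1)^m D(-m) = π Y_m` is L'Hôpital's rule for the quotient defining `Y_m`, whose
numerator vanishes at `m` because `J_{-m} = (-1)^m J_m`. `D(m) - (-1)^m D(-m)` is the finite sum:
after scaling by `(t/2)^m`, both obey one inhomogeneous three-term recurrence in `m`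
(`besselSum_recurrence` and the differentiated Bessel recurrence) and agree at `m = 0, 1`. -/

/-- On every ball the translates `ν ↦ 1 / Γ(ν + k + 1)` are bounded uniformly in `k`. -/
theorem exists_bound_inv_Gamma_add_nat (R : ℝ) :
    ∃ C : ℝ, ∀ (k : ℕ), ∀ ν ∈ Metric.closedBall (0 : ℂ) R,
      ‖(Complex.Gamma (ν + k + 1))⁻¹‖ ≤ C := by
  have hbdd : ∀ k : ℕ, ∃ C : ℝ, ∀ ν ∈ Metric.closedBall (0 : ℂ) R,
      ‖(Complex.Gamma (ν + k + 1))⁻¹‖ ≤ C := by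
    intro k
    refine (isCompact_closedBall (0 : ℂ) R).exists_bound_of_continuousOn ?_
    have h : Continuous fun ν : ℂ => (Complex.Gamma (ν + k + 1))⁻¹ :=
      Complex.differentiable_one_div_Gamma.continuous.comp (by fun_prop : Continuous
        fun ν : ℂ => ν + k + 1)
    exact h.continuousOn
  choose B hB using hbdd
  obtain ⟨N, hN⟩ := exists_nat_ge R
  -- Once `k ≥ N ≥ R`, `|ν + k + 1| ≥ 1`, so `1/Γ(z) = z/Γ(z+1)` makes the norms nonincreasing in
  -- `k`.
  have htail : ∀ j : ℕ, ∀ ν ∈ Metric.closedBall (0 : ℂ) R,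
      ‖(Complex.Gamma (ν + (N + j : ℕ) + 1))⁻¹‖ ≤ B N := by
    intro j
    induction j with
    | zero => exact hB N
    | succ j ih =>
      intro ν hν
      refine le_trans ?_ (ih ν hν)
      have h := Complex.one_div_Gamma_eq_self_mul_one_div_Gamma_add_one (ν + (N + j : ℕ) + 1)
      rw [h, norm_mul]
      have hn : (1 : ℝ) ≤ ‖ν + (N + j : ℕ) + 1‖ := by
        have hν' : ‖ν‖ ≤ R := by simpa using hν
        have h1 := norm_sub_norm_le (((N + j + 1 : ℕ) : ℂ)) (-ν)
        rw [Complex.norm_natCast, norm_neg, sub_neg_eq_add] at h1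
        have h2 : ((N + j + 1 : ℕ) : ℂ) + ν = ν + (N + j : ℕ) + 1 := by push_cast; ring
        rw [h2] at h1
        push_cast at h1 ⊢
        have : (0 : ℝ) ≤ j := j.cast_nonneg
        linarith
      have h3 : ν + ((N + (j + 1) : ℕ) : ℂ) + 1 = ν + (N + j : ℕ) + 1 + 1 := by push_cast; ring
      rw [h3]
      exact le_mul_of_one_le_left (norm_nonneg _) hn
  refine ⟨∑ k ∈ Finset.range (N + 1), |B k|, fun k ν hν => ?_⟩
  have hle : ∀ k ≤ N, B k ≤ ∑ k ∈ Finset.range (N + 1), |B k| := fun k hk =>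
    (le_abs_self _).trans (Finset.single_le_sum (f := fun k => |B k|)
      (fun _ _ => abs_nonneg _) (Finset.mem_range.2 (by omega)))
  rcases le_total k N with hk | hk
  · exact (hB k ν hν).trans (hle k hk)
  · obtain ⟨j, rfl⟩ := Nat.exists_eq_add_of_le hk
    exact (htail j ν hν).trans (hle N le_rfl)

/-- The general term of the ascending series of `(t/2)^(-ν) J_ν(t)`. -/
noncomputable def besselTerm (t : ℂ) (k : ℕ) (ν : ℂ) : ℂ :=
  (-1) ^ k * (t ^ 2 / 4) ^ k * ((Nat.factorial k : ℂ))⁻¹ * (Complex.Gamma (ν + k + 1))⁻¹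

theorem besselJ_eq (ν t : ℂ) : besselJ ν t = (t / 2) ^ ν * ∑' k, besselTerm t k ν := rfl

theorem exists_summable_bound_besselTerm (t : ℂ) (R : ℝ) :
    ∃ u : ℕ → ℝ, Summable u ∧ ∀ (k : ℕ), ∀ ν ∈ Metric.closedBall (0 : ℂ) R,
      ‖besselTerm t k ν‖ ≤ u k := by
  obtain ⟨C, hC⟩ := exists_bound_inv_Gamma_add_nat R
  refine ⟨fun k => ‖t ^ 2 / 4‖ ^ k / (Nat.factorial k : ℝ) * C,
    (Real.summable_pow_div_factorial _).mul_right C, fun k ν hν => ?_⟩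
  have h : ‖besselTerm t k ν‖ =
      ‖t ^ 2 / 4‖ ^ k / (Nat.factorial k : ℝ) * ‖(Complex.Gamma (ν + k + 1))⁻¹‖ := by
    rw [besselTerm, norm_mul, norm_mul, norm_mul, norm_pow, norm_pow, norm_neg, norm_one, one_pow,
      one_mul, norm_inv (Nat.factorial k : ℂ), Complex.norm_natCast, ← div_eq_mul_inv]
  rw [h]
  exact mul_le_mul_of_nonneg_left (hC k ν hν) (by positivity)

theorem summable_besselTerm (t ν : ℂ) : Summable fun k => besselTerm t k ν := by
  obtain ⟨u, hu, h⟩ := exists_summable_bound_besselTerm t ‖ν‖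
  exact Summable.of_norm_bounded hu fun k => h k ν (by simp)

theorem differentiable_tsum_besselTerm (t : ℂ) :
    Differentiable ℂ fun ν => ∑' k, besselTerm t k ν := by
  intro ν
  obtain ⟨u, hu, h⟩ := exists_summable_bound_besselTerm t (‖ν‖ + 1)
  have hd : DifferentiableOn ℂ (fun ν => ∑' k, besselTerm t k ν)
      (Metric.ball (0 : ℂ) (‖ν‖ + 1)) := by
    refine Complex.differentiableOn_tsum_of_summable_norm hu (fun k => ?_) Metric.isOpen_ball
      fun k w hw => h k w (Metric.ball_subset_closedBall hw)
    have hg : Differentiable ℂ fun ν : ℂ => (Complex.Gamma (ν + k + 1))⁻¹ :=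
      Complex.differentiable_one_div_Gamma.comp (by fun_prop : Differentiable ℂ
        fun ν : ℂ => ν + k + 1)
    exact (hg.const_mul _).differentiableOn
  exact hd.differentiableAt (Metric.isOpen_ball.mem_nhds (by simp))

theorem differentiable_besselJ {t : ℂ} (ht : t ≠ 0) : Differentiable ℂ fun ν => besselJ ν t := by
  have ht2 : t / 2 ≠ 0 := div_ne_zero ht two_ne_zero
  intro ν
  exact (differentiableAt_id.const_cpow (Or.inl ht2)).mul (differentiable_tsum_besselTerm t ν)

/-- The three-term recurrence `J_{ν-1}(t) + J_{ν+1}(t) = (2ν/t) J_ν(t)`. -/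
theorem besselJ_recurrence {t : ℂ} (ht : t ≠ 0) (ν : ℂ) :
    t / 2 * (besselJ (ν - 1) t + besselJ (ν + 1) t) = ν * besselJ ν t := by
  have ht2 : t / 2 ≠ 0 := div_ne_zero ht two_ne_zero
  have hser : ∑' k, besselTerm t k (ν - 1) + (t / 2) ^ 2 * ∑' k, besselTerm t k (ν + 1)
      = ν * ∑' k, besselTerm t k ν := by
    have h0 := summable_besselTerm t (ν - 1)
    have h1 := (summable_besselTerm t (ν + 1)).mul_left ((t / 2) ^ 2)
    have h2 := (summable_besselTerm t ν).mul_left ν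
    -- The factor `(t/2)^2` raises the degree, so term `k` of the `ν + 1` series pairs with terms `k
    -- + 1` of the other two.
    rw [← tsum_mul_left, ← tsum_mul_left, h0.tsum_eq_zero_add, h2.tsum_eq_zero_add, add_assoc,
      ← ((summable_nat_add_iff 1).2 h0).tsum_add h1]
    congr 1
    · have h := Complex.one_div_Gamma_eq_self_mul_one_div_Gamma_add_one ν
      simp [besselTerm, h]
    · refine tsum_congr fun k => ?_
      have h := Complex.one_div_Gamma_eq_self_mul_one_div_Gamma_add_one (ν + k + 1)
      have e1 : ν - 1 + ((k + 1 : ℕ) : ℂ) + 1 = ν + k + 1 := by push_cast; ring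
      have e2 : ν + 1 + (k : ℂ) + 1 = ν + k + 1 + 1 := by ring
      have e3 : ν + ((k + 1 : ℕ) : ℂ) + 1 = ν + k + 1 + 1 := by push_cast; ring
      have hk : (k : ℂ) + 1 ≠ 0 := Nat.cast_add_one_ne_zero k
      have hf : (Nat.factorial k : ℂ) ≠ 0 := Nat.cast_ne_zero.2 (Nat.factorial_ne_zero k)
      simp only [besselTerm]
      rw [e1, e2, e3, h, Nat.factorial_succ]
      generalize (Complex.Gamma (ν + k + 1 + 1))⁻¹ = g
      push_cast
      field_simp
      ring
  simp only [besselJ_eq]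
  rw [Complex.cpow_sub _ _ ht2, Complex.cpow_add _ _ ht2, Complex.cpow_one]
  field_simp
  field_simp at hser
  linear_combination (t / 2) ^ ν * hser

theorem besselJ_neg_nat {t : ℂ} (ht : t ≠ 0) (m : ℕ) :
    besselJ (-(m : ℂ)) t = (-1) ^ m * besselJ m t := by
  have ht2 : t / 2 ≠ 0 := div_ne_zero ht two_ne_zero
  induction m using Nat.twoStepInduction with
  | zero => simp
  | one =>
    have h := besselJ_recurrence ht 0
    rw [zero_mul, mul_eq_zero, or_iff_right ht2] at h
    simp only [zero_sub, zero_add] at h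
    simp only [Nat.cast_one]
    linear_combination h
  | more m ih0 ih1 =>
    have h1 := besselJ_recurrence ht ((m : ℂ) + 1)
    have h2 := besselJ_recurrence ht (-((m : ℂ) + 1))
    rw [show (m : ℂ) + 1 - 1 = m by ring, show (m : ℂ) + 1 + 1 = m + 2 by ring] at h1
    rw [show -((m : ℂ) + 1) - 1 = -(m + 2) by ring, show -((m : ℂ) + 1) + 1 = -m by ring] at h2
    push_cast at ih1 ⊢
    apply mul_left_cancel₀ ht2
    rw [ih0, ih1] at h2
    linear_combination h2 - (-1) ^ m * h1

/-- Differentiated three-term recurrence. -/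
theorem deriv_besselJ_recurrence {t : ℂ} (ht : t ≠ 0) (ν : ℂ) :
    t / 2 * (deriv (fun ν => besselJ ν t) (ν - 1) + deriv (fun ν => besselJ ν t) (ν + 1))
      = besselJ ν t + ν * deriv (fun ν => besselJ ν t) ν := by
  have hd := differentiable_besselJ ht
  have h1 : HasDerivAt (fun ν => t / 2 * (besselJ (ν - 1) t + besselJ (ν + 1) t))
      (t / 2 * (deriv (fun ν => besselJ ν t) (ν - 1) + deriv (fun ν => besselJ ν t) (ν + 1))) ν :=
    (((hd (ν - 1)).hasDerivAt.comp_sub_const ν 1).add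
      ((hd (ν + 1)).hasDerivAt.comp_add_const ν 1)).const_mul (t / 2)
  have h2 : HasDerivAt (fun ν => ν * besselJ ν t)
      (1 * besselJ ν t + ν * deriv (fun ν => besselJ ν t) ν) ν :=
    (hasDerivAt_id ν).mul (hd ν).hasDerivAt
  rw [funext (besselJ_recurrence ht)] at h1
  simpa using h1.unique h2

/-- The finite sum `∑_{k<m} m! / (k! (m-k)) x^k f_k`. -/
noncomputable def besselSum (x : ℂ) (f : ℕ → ℂ) (m : ℕ) : ℂ :=
  ∑ k ∈ Finset.range m, (Nat.factorial m : ℂ) / ((Nat.factorial k : ℂ) * ((m : ℂ) - k)) * x ^ k * f k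

/-- With `w_k = x^k f_k / k!`, the sum is `n! ∑ w_k / (n-k)`. The factorizations `(m+1)² - j² =
(m+1-j)(m+1+j)` and `(m+2)(m+1) - j(j-1) = (m+2-j)(m+1+j)` cancel the denominators and leave the
same weight `m+1+j`, so only the term `j = m+1` survives. -/
theorem besselSum_recurrence {x : ℂ} {f : ℕ → ℂ}
    (hf : ∀ k : ℕ, x * (f k + f (k + 2)) = ((k : ℂ) + 1) * f (k + 1)) (m : ℕ) :
    besselSum x f (m + 2) + x ^ 2 * besselSum x f m
      = (m + 1) * besselSum x f (m + 1) + 2 * x ^ (m + 1) * f (m + 1) := by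
  have hfac : ∀ k : ℕ, (Nat.factorial k : ℂ) ≠ 0 := fun k =>
    Nat.cast_ne_zero.2 (Nat.factorial_ne_zero k)
  set w : ℕ → ℂ := fun k => x ^ k * f k / Nat.factorial k with hw
  have hP : ∀ n, besselSum x f n
      = Nat.factorial n * ∑ k ∈ Finset.range n, w k / ((n : ℂ) - k) := by
    intro n
    rw [besselSum, Finset.mul_sum]
    refine Finset.sum_congr rfl fun k _ => ?_
    rw [hw, ← div_div]
    ring
  have hrec : ∀ k : ℕ, x ^ 2 * w k
      = ((k : ℂ) + 1) ^ 2 * w (k + 1) - ((k : ℂ) + 1) * (k + 2) * w (k + 2) := by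
    intro k
    have h1 : (k : ℂ) + 1 ≠ 0 := Nat.cast_add_one_ne_zero k
    have h2 : (k : ℂ) + 2 ≠ 0 := by exact_mod_cast (Nat.succ_ne_zero (k + 1))
    have := hfac k
    simp only [hw, Nat.factorial_succ]
    push_cast
    rw [show (k : ℂ) + 1 + 1 = k + 2 by ring]
    field_simp
    linear_combination x * x ^ k * hf k
  have hshift : x ^ 2 * ∑ k ∈ Finset.range m, w k / ((m : ℂ) - k)
      = ∑ j ∈ Finset.range (m + 1), (j : ℂ) ^ 2 * w j / ((m : ℂ) + 1 - j)
        - ∑ j ∈ Finset.range (m + 2), (j : ℂ) * (j - 1) * w j / ((m : ℂ) + 2 - j) := by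
    -- The terms `j = 0` and `j = 1` added by the shift vanish through the factors `j²` and
    -- `j(j-1)`.
    rw [Finset.sum_range_succ', Finset.sum_range_succ' _ (m + 1), Finset.sum_range_succ' _ m]
    simp only [Nat.cast_zero, Nat.cast_add, Nat.cast_one, zero_mul, zero_div, add_zero, zero_add,
      sub_self, mul_zero, ne_eq, OfNat.ofNat_ne_zero, not_false_eq_true, zero_pow]
    rw [Finset.mul_sum, ← Finset.sum_sub_distrib]
    refine Finset.sum_congr rfl fun k _ => ?_
    rw [← mul_div_assoc, hrec, show (m : ℂ) + 1 - (k + 1) = m - k by ring,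
      show (m : ℂ) + 2 - (k + 1 + 1) = m - k by ring]
    ring
  have h1 : ∑ j ∈ Finset.range (m + 1), ((m : ℂ) + 1 + j) * w j
      = (m + 1) ^ 2 * ∑ j ∈ Finset.range (m + 1), w j / ((m : ℂ) + 1 - j)
        - ∑ j ∈ Finset.range (m + 1), (j : ℂ) ^ 2 * w j / ((m : ℂ) + 1 - j) := by
    rw [Finset.mul_sum, ← Finset.sum_sub_distrib]
    refine Finset.sum_congr rfl fun j hj => ?_
    have hne : (m : ℂ) + 1 - j ≠ 0 := by
      have : m + 1 ≠ j := (Finset.mem_range.1 hj).ne'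
      exact sub_ne_zero.2 (by exact_mod_cast this)
    field_simp
    ring
  have h2 : ∑ j ∈ Finset.range (m + 2), ((m : ℂ) + 1 + j) * w j
      = (m + 2) * (m + 1) * ∑ j ∈ Finset.range (m + 2), w j / ((m : ℂ) + 2 - j)
        - ∑ j ∈ Finset.range (m + 2), (j : ℂ) * (j - 1) * w j / ((m : ℂ) + 2 - j) := by
    rw [Finset.mul_sum, ← Finset.sum_sub_distrib]
    refine Finset.sum_congr rfl fun j hj => ?_
    have hne : (m : ℂ) + 2 - j ≠ 0 := by
      have : m + 2 ≠ j := (Finset.mem_range.1 hj).ne'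
      exact sub_ne_zero.2 (by exact_mod_cast this)
    field_simp
    ring
  have h3 := Finset.sum_range_succ (fun j : ℕ => ((m : ℂ) + 1 + j) * w j) (m + 1)
  have h4 : (Nat.factorial m : ℂ) * ((m + 1) * w (m + 1)) = x ^ (m + 1) * f (m + 1) := by
    have := hfac m
    have : (m : ℂ) + 1 ≠ 0 := Nat.cast_add_one_ne_zero m
    simp only [hw, Nat.factorial_succ]
    push_cast
    field_simp
  rw [h1, show m + 1 + 1 = m + 2 from rfl, h2] at h3
  rw [hP, hP, hP, Nat.factorial_succ, Nat.factorial_succ]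
  push_cast at h3 ⊢
  linear_combination (Nat.factorial m : ℂ) * (h3 + hshift) + 2 * h4

/-- `J'_m - (-1)^m J'_{-m}` (derivatives in the order) as a finite sum. -/
theorem deriv_besselJ_sub {t : ℂ} (ht : t ≠ 0) (m : ℕ) :
    (t / 2) ^ m * (deriv (fun ν => besselJ ν t) m
        - (-1) ^ m * deriv (fun ν => besselJ ν t) (-(m : ℂ)))
      = besselSum (t / 2) (fun k => besselJ k t) m := by
  have hf : ∀ k : ℕ, t / 2 * (besselJ (k : ℂ) t + besselJ ((k + 2 : ℕ) : ℂ) t)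
      = ((k : ℂ) + 1) * besselJ ((k + 1 : ℕ) : ℂ) t := by
    intro k
    have h := besselJ_recurrence ht ((k : ℂ) + 1)
    rw [show (k : ℂ) + 1 - 1 = k by ring, show (k : ℂ) + 1 + 1 = k + 2 by ring] at h
    exact_mod_cast h
  induction m using Nat.twoStepInduction with
  | zero => simp [besselSum]
  | one =>
    have h := deriv_besselJ_recurrence ht 0
    simp only [zero_sub, zero_add, zero_mul, add_zero] at h
    simp [besselSum]
    linear_combination h
  | more m ih0 ih1 =>
    have hS := besselSum_recurrence (x := t / 2) (f := fun k : ℕ => besselJ (k : ℂ) t) hf m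
    have h1 := deriv_besselJ_recurrence ht ((m : ℂ) + 1)
    have h2 := deriv_besselJ_recurrence ht (-((m : ℂ) + 1))
    -- By this reflection the inhomogeneous terms of `h1` and `-(-1)^m * h2` add up to `2 J_{m+1}`.
    have h3 := besselJ_neg_nat ht (m + 1)
    rw [show (m : ℂ) + 1 - 1 = m by ring, show (m : ℂ) + 1 + 1 = m + 2 by ring] at h1
    rw [show -((m : ℂ) + 1) - 1 = -(m + 2) by ring, show -((m : ℂ) + 1) + 1 = -m by ring] at h2
    rw [← ih0, ← ih1] at hS
    have hs : ((-1 : ℂ) ^ m) ^ 2 = 1 := by rw [← pow_mul, mul_comm, pow_mul]; simp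
    push_cast at *
    rw [h3] at h2
    simp only [pow_succ] at *
    linear_combination (exp := 1) -hS + (t / 2) ^ m * (t / 2) * h1
      - (t / 2) ^ m * (t / 2) * (-1) ^ m * h2 + (t / 2) ^ m * (t / 2) * besselJ (m + 1) t * hs

/-- A quotient of two functions vanishing at `a` tends to the quotient of the derivatives. -/
theorem HasDerivAt.tendsto_div_of_eq_zero {f g : ℂ → ℂ} {f' g' a : ℂ} (hf : HasDerivAt f f' a)
    (hg : HasDerivAt g g' a) (hfa : f a = 0) (hga : g a = 0) (hg' : g' ≠ 0) :
    Filter.Tendsto (fun z => f z / g z) (𝓝[≠] a) (𝓝 (f' / g')) := by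
  refine (hf.tendsto_slope.div hg.tendsto_slope hg').congr' ?_
  filter_upwards [self_mem_nhdsWithin] with z hz
  have hz' : z - a ≠ 0 := sub_ne_zero.2 hz
  simp only [Pi.div_apply, slope_def_field, hfa, hga, sub_zero]
  exact div_div_div_cancel_right₀ hz' _ _

/-- `π Y_m = J'_m + (-1)^m J'_{-m}`, with derivatives in the order. -/
theorem pi_mul_besselY_nat {t : ℂ} (ht : t ≠ 0) (m : ℕ) :
    (Real.pi : ℂ) * besselY m t = deriv (fun ν => besselJ ν t) m
        + (-1) ^ m * deriv (fun ν => besselJ ν t) (-(m : ℂ)) := by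
  have hd := differentiable_besselJ ht
  have hpi : (Real.pi : ℂ) ≠ 0 := Complex.ofReal_ne_zero.2 Real.pi_ne_zero
  have hs : ((-1 : ℂ) ^ m) ^ 2 = 1 := by rw [← pow_mul, mul_comm, pow_mul]; simp
  have hlin : HasDerivAt (fun ν : ℂ => ν * Real.pi) (Real.pi : ℂ) m := by
    simpa using (hasDerivAt_id (m : ℂ)).mul_const (Real.pi : ℂ)
  have hsin : HasDerivAt (fun ν : ℂ => Complex.sin (ν * Real.pi))
      (Complex.cos (m * Real.pi) * Real.pi) m := hlin.csin
  have hcos : HasDerivAt (fun ν : ℂ => Complex.cos (ν * Real.pi))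
      (-Complex.sin (m * Real.pi) * Real.pi) m := hlin.ccos
  have hneg : HasDerivAt (fun ν : ℂ => besselJ (-ν) t)
      (deriv (fun ν => besselJ ν t) (-(m : ℂ)) * -1) m :=
    (hd (-(m : ℂ))).hasDerivAt.comp (m : ℂ) (hasDerivAt_neg (m : ℂ))
  have hnum := ((hd m).hasDerivAt.mul hcos).sub hneg
  have hc : Complex.cos (m * Real.pi) = (-1) ^ m := by
    exact_mod_cast congrArg (Complex.ofReal) (Real.cos_nat_mul_pi m)
  have hs0 : Complex.sin (m * Real.pi) = 0 := Complex.sin_nat_mul_pi m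
  have hlim : Filter.Tendsto (fun μ : ℂ => besselYQuotient μ t) (𝓝[≠] (m : ℂ)) _ :=
    hnum.tendsto_div_of_eq_zero hsin
      (by simp only [Pi.sub_apply, Pi.mul_apply, hc, besselJ_neg_nat ht]; ring) hs0
      (by rw [hc]; exact mul_ne_zero (pow_ne_zero _ (by norm_num)) hpi)
  have hY : besselY m t = _ := (if_pos ⟨(m : ℤ), by simp⟩ : besselY m t = _).trans hlim.limUnder_eq
  -- Since `sin(mπ) = 0`, the derivative of the cosine drops out.
  rw [hY, hc, hs0]
  have h1 : (-1 : ℂ) ^ m ≠ 0 := pow_ne_zero _ (by norm_num)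
  field_simp
  linear_combination (-deriv (fun ν => besselJ ν t) (-(m : ℂ))) * hs

theorem mainTheorem8 (m : ℕ) (t : ℂ) (ht : t ≠ 0) :
    HasDerivAt (fun ν : ℂ => besselJ ν t)
      ((1 : ℂ) ^ m * ((Real.pi : ℂ) / 2 * besselY (m : ℂ) t
        + (Nat.factorial m : ℂ) / 2 *
          ∑ k ∈ Finset.range m,
            besselJ (k : ℂ) t / ((Nat.factorial k : ℂ) * ((m : ℂ) - (k : ℂ))) *
              (t / 2) ^ ((k : ℤ) - (m : ℤ))))
      (m : ℂ) ∧
    HasDerivAt (fun ν : ℂ => besselJ ν t)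
      ((-1 : ℂ) ^ m * ((Real.pi : ℂ) / 2 * besselY (m : ℂ) t
        - (Nat.factorial m : ℂ) / 2 *
          ∑ k ∈ Finset.range m,
            besselJ (k : ℂ) t / ((Nat.factorial k : ℂ) * ((m : ℂ) - (k : ℂ))) *
              (t / 2) ^ ((k : ℤ) - (m : ℤ))))
      (-(m : ℂ)) := by
  have ht2 : t / 2 ≠ 0 := div_ne_zero ht two_ne_zero
  have hd := differentiable_besselJ ht
  have hY := pi_mul_besselY_nat ht m
  have hs : ((-1 : ℂ) ^ m) ^ 2 = 1 := by rw [← pow_mul, mul_comm, pow_mul]; simp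
  have hF : (Nat.factorial m : ℂ) * ∑ k ∈ Finset.range m,
      besselJ (k : ℂ) t / ((Nat.factorial k : ℂ) * ((m : ℂ) - (k : ℂ))) *
        (t / 2) ^ ((k : ℤ) - (m : ℤ)) = deriv (fun ν => besselJ ν t) m
        - (-1) ^ m * deriv (fun ν => besselJ ν t) (-(m : ℂ)) := by
    apply mul_left_cancel₀ (pow_ne_zero m ht2)
    rw [deriv_besselJ_sub ht, besselSum, Finset.mul_sum, Finset.mul_sum]
    refine Finset.sum_congr rfl fun k _ => ?_
    rw [zpow_sub₀ ht2, zpow_natCast, zpow_natCast]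
    have := pow_ne_zero m ht2
    generalize (t / 2) ^ m = y at *
    field_simp
  constructor
  · refine (hd m).hasDerivAt.congr_deriv ?_
    rw [one_pow]
    linear_combination -hY / 2 - hF / 2
  · refine (hd (-(m : ℂ))).hasDerivAt.congr_deriv ?_
    linear_combination -(-1) ^ m * (hY / 2 - hF / 2)
      - deriv (fun ν => besselJ ν t) (-(m : ℂ)) * hs
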